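/- The magic square game: Alice and Bob receive $x^{(A)},x^{(B)}\in\{1,2,3\}$ and, without communicating, output bits $(y^{(A)}_1,y^{(A)}_2,y^{(A)}_3)$ and $(y^{(B)}_1,y^{(B)}_2,y^{(B)}_3)$. They win if $y^{(A)}_3=y^{(A)}_1\oplus y^{(A)}_2$, $\;y^{(B)}_3=y^{(B)}_1\oplus y^{(B)}_2\oplus 1$ and $y^{(A)}_{x^{(B)}}=y^{(B)}_{x^{(A)}}$. The magic square correlations are the conditional probabilities $\Pr(y^{(A)},y^{(B)}\mid x^{(A)},x^{(B)})$ under which, for every input pair, the output pair is uniformly distributed among all winning output pairs. A non-local box (NLB) takes a bit $u$ from Alice and a bit $v$ from Bob and returns bits $s$ to Alice and $t$ to Bob with $s\oplus t=u\wedge v$, both solutions being equally likely. **Corollary.** An NLB can simulate bipartite correlations that no pair of qubits $\alpha|00\rangle+\beta|11\rangle$ can produce. Precisely: 1. The magic square correlations win the magic square game with probability one on every input pair, and they are obtained from local measurements (POVMs) of the state $\frac12(|0011\rangle-|0110\rangle-|1001\rangle+|1100\rangle)$, of which Alice holds the first two qubits and Bob the last two. 2. There is a classical protocol without communication, with (finite)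 shared randomness and a single use of one NLB, that produces exactly the magic square correlations. 3. For all $\alpha,\beta\in\mathbb{C}$ with $|\alpha|^2+|\beta|^2=1$, no choice of local measurements (POVMs) of the state $\alpha|00\rangle+\beta|11\rangle$, of which each player holds one qubit, produces the magic square correlations, or any other correlations that win the magic square game with probability one on every input pair. This remains true if the measurements may also depend on shared classical randomness. -/

import Mathlib

open scoped Kronecker Matrix ComplexOrder

noncomputable section

/-- A bipartite game: Alice has inputs `XA` and outputs `YA`, Bob has inputs `XB` and outputs
`YB`, and `rel` is the winning relation. -/
structure BipartiteGame (XA XB YA YB : Type) where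
  rel : XA → XB → YA → YB → Prop

/-- A table of conditional probabilities `p x y a b = Pr (a, b | x, y)`. -/
abbrev Correlation (XA XB YA YB : Type) : Type := XA → XB → YA → YB → ℝ

section General

variable {XA XB YA YB : Type} [Fintype YA] [Fintype YB]

open Classical in
/-- On every input pair, the outputs satisfy the winning relation with probability one. -/
def BipartiteGame.IsWonBy (G : BipartiteGame XA XB YA YB) (p : Correlation XA XB YA YB) : Prop :=
  ∀ x y, ∑ a, ∑ b, (if G.rel x y a b then p x y a b else 0) = 1

open Classical in
/-- On every input pair, the outputs are uniform among all winning output pairs. -/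
def BipartiteGame.uniformWinning (G : BipartiteGame XA XB YA YB) : Correlation XA XB YA YB :=
  fun x y a b =>
    if G.rel x y a b then 1 / (Nat.card {o : YA × YB // G.rel x y o.1 o.2} : ℝ) else 0

end General

/-- The magic square game (inputs indexed by `0, 1, 2`). -/
def magicSquareGame : BipartiteGame (Fin 3) (Fin 3) (Fin 3 → Bool) (Fin 3 → Bool) where
  rel xA xB yA yB :=
    yA 2 = xor (yA 0) (yA 1) ∧
    yB 2 = xor (xor (yB 0) (yB 1)) true ∧
    yA xB = yB xA

/-- The magic square correlations. -/
def magicSquareCorrelation : Correlation (Fin 3) (Fin 3) (Fin 3 → Bool) (Fin 3 → Bool) :=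
  magicSquareGame.uniformWinning

/-! Non-local boxes -/

/-- The non-local box: `nlb u v s t` is the probability that it returns `s` to Alice and `t` to
Bob on inputs `u` and `v`. The two solutions of `u ∧ v = s ⊕ t` are equally likely. -/
def nlb (u v s t : Bool) : ℝ := if (u && v) = xor s t then 1 / 2 else 0

/-- A classical protocol without communication that uses one non-local box once. The players
share a random value `r`, drawn from a finite set `Λ` with probability `weight r`. Each player
computes an input to the box from `r` and the player's own game input, and then the final output
from these and the bit that the box returned. -/
structure NLBProtocol (XA XB YA YB : Type) where
  Λ : Type
  [fintypeΛ : Fintype Λ]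
  weight : Λ → ℝ
  weight_nonneg : ∀ r, 0 ≤ weight r
  weight_sum : ∑ r, weight r = 1
  boxA : Λ → XA → Bool
  boxB : Λ → XB → Bool
  outA : Λ → XA → Bool → YA
  outB : Λ → XB → Bool → YB

attribute [instance] NLBProtocol.fintypeΛ

open Classical in
/-- The correlation that a protocol with one non-local box produces. -/
def NLBProtocol.correlation {XA XB YA YB : Type} (P : NLBProtocol XA XB YA YB) :
    Correlation XA XB YA YB :=
  fun x y a b =>
    ∑ r, P.weight r * ∑ s, ∑ t,
      if P.outA r x s = a ∧ P.outB r y t = b then nlb (P.boxA r x) (P.boxB r y) s t else 0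

/-! Quantum strategies -/

/-- A measurement (POVM) with outcomes in `Y` on the system with Hilbert space `ℂ^n`. -/
structure POVM (n Y : Type) [Fintype n] [DecidableEq n] [Fintype Y] where
  effect : Y → Matrix n n ℂ
  posSemidef : ∀ a, (effect a).PosSemidef
  sum_eq_one : ∑ a, effect a = 1

section Quantum

variable {m n XA XB YA YB : Type} [Fintype m] [DecidableEq m] [Fintype n] [DecidableEq n]
  [Fintype YA] [Fintype YB]

/-- The Born rule `⟨ψ| E ⊗ F |ψ⟩`. -/
def bornProb (ψ : m × n → ℂ) (E : Matrix m m ℂ) (F : Matrix n n ℂ) : ℝ :=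
  (star ψ ⬝ᵥ ((E ⊗ₖ F) *ᵥ ψ)).re

/-- `p` arises from local measurements, chosen according to the inputs, of the shared state `ψ`. -/
def IsQuantum (ψ : m × n → ℂ) (p : Correlation XA XB YA YB) : Prop :=
  ∃ (M : XA → POVM m YA) (N : XB → POVM n YB),
    ∀ x y a b, p x y a b = bornProb ψ ((M x).effect a) ((N y).effect b)

/-- `p` arises from local measurements of the shared state `ψ`, where the measurements may also
depend on shared classical randomness, given by an arbitrary probability space. -/
def IsQuantumWithSharedRandomness (ψ : m × n → ℂ) (p : Correlation XA XB YA YB) : Prop :=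
  ∃ (Ω : Type) (_ : MeasurableSpace Ω) (μ : MeasureTheory.Measure Ω)
    (_ : MeasureTheory.IsProbabilityMeasure μ)
    (M : Ω → XA → POVM m YA) (N : Ω → XB → POVM n YB),
    (∀ x a i j, Measurable fun ω => (M ω x).effect a i j) ∧
    (∀ y b i j, Measurable fun ω => (N ω y).effect b i j) ∧
    ∀ x y a b, p x y a b = ∫ ω, bornProb ψ ((M ω x).effect a) ((N ω y).effect b) ∂μ

end Quantum

/-- The state `α|00⟩ + β|11⟩` of a pair of qubits, one held by each player. -/
def qubitPair (α β : ℂ) : Fin 2 × Fin 2 → ℂ :=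
  α • Pi.single (0, 0) 1 + β • Pi.single (1, 1) 1

/-- The basis vector `|i j k l⟩` of four qubits: Alice holds the first two, Bob the last two. -/
def ket4 (i j k l : Fin 2) : (Fin 2 × Fin 2) × (Fin 2 × Fin 2) → ℂ :=
  Pi.single ((i, j), (k, l)) 1

/-- The state `(|0011⟩ - |0110⟩ - |1001⟩ + |1100⟩) / 2`. -/
def magicState : (Fin 2 × Fin 2) × (Fin 2 × Fin 2) → ℂ :=
  (1 / 2 : ℂ) • (ket4 0 0 1 1 - ket4 0 1 1 0 - ket4 1 0 0 1 + ket4 1 1 0 0)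

end

/-!
When a strategy wins with certainty, Alice and Bob measure for each cell `(x, y)` the same
`±1`-valued observable on the support of the state. These nine observables satisfy the relations of
the magic square, so any two of them that share neither a row nor a column anticommute. Hence all of
them have trace zero, and each joint eigenspace of a row is exactly a quarter of the space: `4`
divides the Schmidt rank of the state, whereas a pair of qubits has rank at most `2`. Conversely, on
a maximally entangled state Bob can mirror the measurements of Alice, and the same traces show that
any magic square of observables then produces the magic square correlations.

Classically, the players can agree on a row filling and a column filling that differ in a single
cell. On the inputs `x = 2` and `y = 2`, the two bits that a box returns differ in exactly this
cell, so it suffices that each player whose bit is set flips an even number of outputs, the one in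
this cell among them. Adding a shared random matrix with even rows and columns makes the outputs
uniform.
-/

section General

variable {XA XB YA YB : Type} [Fintype YA] [Fintype YB]

theorem BipartiteGame.isWonBy_uniformWinning (G : BipartiteGame XA XB YA YB)
    (h : ∀ x y, ∃ a b, G.rel x y a b) : G.IsWonBy G.uniformWinning := by
  classical
  intro x y
  have hcard : (Nat.card {o : YA × YB // G.rel x y o.1 o.2} : ℝ) ≠ 0 := by
    obtain ⟨a, b, hab⟩ := h x y
    have : Nonempty {o : YA × YB // G.rel x y o.1 o.2} := ⟨⟨(a, b), hab⟩⟩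
    exact_mod_cast Nat.card_pos.ne'
  calc ∑ a, ∑ b, (if G.rel x y a b then G.uniformWinning x y a b else 0)
      = ∑ o : YA × YB, if G.rel x y o.1 o.2
          then 1 / (Nat.card {o : YA × YB // G.rel x y o.1 o.2} : ℝ) else 0 := by
        rw [Fintype.sum_prod_type]
        refine Finset.sum_congr rfl fun a _ => Finset.sum_congr rfl fun b _ => ?_
        by_cases hab : G.rel x y a b <;> simp [BipartiteGame.uniformWinning, hab]
    _ = 1 := by
        rw [← Finset.sum_filter, Finset.sum_const, nsmul_eq_mul, ← Fintype.card_subtype,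
          ← Nat.card_eq_fintype_card, mul_one_div_cancel hcard]

theorem BipartiteGame.IsWonBy.eq_zero_of_not_rel {G : BipartiteGame XA XB YA YB}
    {p : Correlation XA XB YA YB} (hG : G.IsWonBy p) (hp : ∀ x y a b, 0 ≤ p x y a b)
    (hsum : ∀ x y, ∑ a, ∑ b, p x y a b = 1) {x : XA} {y : XB} {a : YA} {b : YB}
    (hab : ¬ G.rel x y a b) : p x y a b = 0 := by
  classical
  have hle : ∀ o ∈ (Finset.univ : Finset (YA × YB)),
      (if G.rel x y o.1 o.2 then p x y o.1 o.2 else 0) ≤ p x y o.1 o.2 := by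
    intro o _
    split_ifs
    exacts [le_rfl, hp x y o.1 o.2]
  have hsum_eq : ∑ o : YA × YB, (if G.rel x y o.1 o.2 then p x y o.1 o.2 else 0) =
      ∑ o : YA × YB, p x y o.1 o.2 := by
    rw [Fintype.sum_prod_type, Fintype.sum_prod_type, hsum x y]
    exact hG x y
  simpa [hab] using ((Finset.sum_eq_sum_iff_of_le hle).mp hsum_eq (a, b) (Finset.mem_univ _)).symm

end General

/-- The exclusive or of the three bits of `a` is `k`: the constraint that the magic square game
puts on Alice's output for `k = false`, and on Bob's for `k = true`. -/
def HasParity (k : Bool) (a : Fin 3 → Bool) : Prop := a 2 = xor (xor (a 0) (a 1)) k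

instance (k : Bool) : DecidablePred (HasParity k) := fun _ => inferInstanceAs (Decidable (_ = _))

instance (x y : Fin 3) (a b : Fin 3 → Bool) : Decidable (magicSquareGame.rel x y a b) :=
  inferInstanceAs (Decidable (_ ∧ _ ∧ _))

theorem HasParity.xor_iff {k : Bool} {a₀ : Fin 3 → Bool} (h : HasParity k a₀)
    (a : Fin 3 → Bool) : HasParity false (fun i => xor (a i) (a₀ i)) ↔ HasParity k a := by
  revert k a₀ a
  decide

theorem magicSquareGame_rel_iff {x y : Fin 3} {a b : Fin 3 → Bool} :
    magicSquareGame.rel x y a b ↔ HasParity false a ∧ HasParity true b ∧ a y = b x := by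
  simp only [magicSquareGame, HasParity, Bool.xor_false]

theorem card_magicSquareGame_rel (x y : Fin 3) :
    Fintype.card {o : (Fin 3 → Bool) × (Fin 3 → Bool) // magicSquareGame.rel x y o.1 o.2} = 8 := by
  revert x y
  decide +kernel

theorem magicSquareCorrelation_apply (x y : Fin 3) (a b : Fin 3 → Bool) :
    magicSquareCorrelation x y a b = if magicSquareGame.rel x y a b then 1 / 8 else 0 := by
  simp [magicSquareCorrelation, BipartiteGame.uniformWinning, card_magicSquareGame_rel]

theorem isWonBy_magicSquareCorrelation : magicSquareGame.IsWonBy magicSquareCorrelation := by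
  refine magicSquareGame.isWonBy_uniformWinning fun x y => ?_
  have : Nonempty {o : (Fin 3 → Bool) × (Fin 3 → Bool) // magicSquareGame.rel x y o.1 o.2} :=
    Fintype.card_pos_iff.mp (by simp [card_magicSquareGame_rel])
  obtain ⟨⟨a, b⟩, hab⟩ := this
  exact ⟨a, b, hab⟩

/-! ### The protocol with a non-local box -/

theorem sum_nlb (u v : Bool) : ∑ s, ∑ t, nlb u v s t = 1 := by
  cases u <;> cases v <;> norm_num [nlb]

/-- The `0`-`1` matrices with even rows and columns, parametrized by their upper left `2 × 2`
block. A uniformly random one is the shared randomness of the protocol. -/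
def evenMatrix (r : Bool × Bool × Bool × Bool) : Fin 3 → Fin 3 → Bool :=
  let (p, q, s, t) := r
  ![![p, q, xor p q], ![s, t, xor s t], ![xor p s, xor q t, xor (xor p q) (xor s t)]]

theorem card_filter_evenMatrix_eq (x y : Fin 3) (d e : Fin 3 → Bool) :
    Finset.card {r | evenMatrix r x = d ∧ (fun i => evenMatrix r i y) = e} =
      if HasParity false d ∧ HasParity false e ∧ d y = e x then 2 else 0 := by
  revert x y d e
  decide +kernel

/-- The even matrix that is supported on the last two rows and columns. A player adds it when the
box returns `true`: the players then disagree about its cells exactly when the box says so. -/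
def flipMatrix : Fin 3 → Fin 3 → Bool := evenMatrix (false, false, false, true)

/-- Alice's output before randomization: the row `(1, 1, 0)` on the last input and `0` otherwise,
plus her row of `flipMatrix` if the box returned `true`. -/
def boxOutputA (x : Fin 3) (s : Bool) : Fin 3 → Bool :=
  fun j => xor (s && flipMatrix x j) (decide (x = 2) && !decide (j = 2))

/-- Bob's output before randomization: the column `(0, 0, 1)`, plus his column of `flipMatrix` if
the box returned `true`. Without the box he would disagree with Alice in the last cell only. -/
def boxOutputB (y : Fin 3) (t : Bool) : Fin 3 → Bool :=
  fun i => xor (t && flipMatrix i y) (decide (i = 2))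

theorem rel_boxOutput {x y : Fin 3} {s t : Bool}
    (h : (decide (x = 2) && decide (y = 2)) = xor s t) :
    magicSquareGame.rel x y (boxOutputA x s) (boxOutputB y t) := by
  revert x y s t
  decide

/-- The protocol for the magic square game with one non-local box: the players win with
`boxOutputA` and `boxOutputB`, and randomize by a shared even matrix. -/
noncomputable def magicSquareProtocol :
    NLBProtocol (Fin 3) (Fin 3) (Fin 3 → Bool) (Fin 3 → Bool) where
  Λ := Bool × Bool × Bool × Bool
  weight _ := 1 / 16
  weight_nonneg _ := by norm_num
  weight_sum := by norm_num
  boxA _ x := decide (x = 2)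
  boxB _ y := decide (y = 2)
  outA r x s := fun j => xor (evenMatrix r x j) (boxOutputA x s j)
  outB r y t := fun i => xor (evenMatrix r i y) (boxOutputB y t i)

theorem card_filter_xor_evenMatrix_eq {x y : Fin 3} {a₀ b₀ : Fin 3 → Bool}
    (h : magicSquareGame.rel x y a₀ b₀) (a b : Fin 3 → Bool) :
    Finset.card {r | (fun j => xor (evenMatrix r x j) (a₀ j)) = a ∧
      (fun i => xor (evenMatrix r i y) (b₀ i)) = b} =
      if magicSquareGame.rel x y a b then 2 else 0 := by
  obtain ⟨ha₀, hb₀, hxy⟩ := magicSquareGame_rel_iff.mp h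
  have hmove (f f₀ g : Fin 3 → Bool) :
      (fun i => xor (f i) (f₀ i)) = g ↔ f = fun i => xor (g i) (f₀ i) := by
    simp only [funext_iff]
    exact forall_congr' fun i => by cases f i <;> cases f₀ i <;> cases g i <;> decide
  simp only [hmove, card_filter_evenMatrix_eq, ha₀.xor_iff, hb₀.xor_iff, hxy, Bool.xor_left_inj,
    magicSquareGame_rel_iff]

open Classical in
theorem NLBProtocol.correlation_apply {XA XB YA YB : Type} (P : NLBProtocol XA XB YA YB)
    (x : XA) (y : XB) (a : YA) (b : YB) :
    P.correlation x y a b = ∑ s, ∑ t, ∑ r, if P.outA r x s = a ∧ P.outB r y t = b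
      then P.weight r * nlb (P.boxA r x) (P.boxB r y) s t else 0 := by
  simp only [NLBProtocol.correlation, Finset.mul_sum, mul_ite, mul_zero]
  rw [Finset.sum_comm]
  exact Finset.sum_congr rfl fun s _ => Finset.sum_comm

theorem magicSquareProtocol_correlation :
    magicSquareProtocol.correlation = magicSquareCorrelation := by
  funext x y a b
  let box s t := nlb (decide (x = 2)) (decide (y = 2)) s t
  let hits s t r := (fun j => xor (evenMatrix r x j) (boxOutputA x s j)) = a ∧
    (fun i => xor (evenMatrix r i y) (boxOutputB y t i)) = b
  have hcount s t : (∑ r, if hits s t r then 1 / 16 * box s t else 0) =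
      (if magicSquareGame.rel x y a b then 1 / 8 else 0) * box s t := by
    by_cases hst : (decide (x = 2) && decide (y = 2)) = xor s t
    · rw [← Finset.sum_filter, Finset.sum_const,
        card_filter_xor_evenMatrix_eq (rel_boxOutput hst)]
      split_ifs
      · rw [nsmul_eq_mul]
        push_cast
        ring
      · rw [zero_nsmul, zero_mul]
    · simp [box, nlb, hst]
  calc magicSquareProtocol.correlation x y a b
      = ∑ s, ∑ t, ∑ r, if hits s t r then 1 / 16 * box s t else 0 :=
        (magicSquareProtocol.correlation_apply x y a b).trans <|
          Finset.sum_congr rfl fun s _ => Finset.sum_congr rfl fun t _ =>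
            Finset.sum_congr rfl fun r _ => ite_congr rfl (fun _ => rfl) fun _ => rfl
    _ = if magicSquareGame.rel x y a b then 1 / 8 else 0 := by
        simp only [hcount, ← Finset.mul_sum, box, sum_nlb, mul_one]
    _ = magicSquareCorrelation x y a b := (magicSquareCorrelation_apply x y a b).symm

/-! ### Magic squares in a ring -/

section Ring

variable {R : Type*} [Ring R]

/-- The eigenvalue `(-1) ^ c` by which a `±1`-valued observable encodes the outcome `c`. -/
def bitSign (c : Bool) : ℤ := if c then -1 else 1

theorem bitSign_mul_self (c : Bool) : bitSign c * bitSign c = 1 := by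
  cases c <;> rfl

theorem HasParity.bitSign_mul {k : Bool} {a : Fin 3 → Bool} (h : HasParity k a) {i j l : Fin 3}
    (hij : i ≠ j) (hil : i ≠ l) (hjl : j ≠ l) :
    bitSign (a i) * bitSign (a j) = bitSign k * bitSign (a l) := by
  revert k a i j l
  decide

/-- Three commuting involutions whose product is `(-1) ^ k`. That they commute is part of
`mul_of_ne`, which applies to both orders of `i` and `j`. -/
structure IsParityTriple (k : Bool) (A : Fin 3 → R) : Prop where
  mul_self : ∀ i, A i * A i = 1
  mul_of_ne : ∀ {i j l}, i ≠ j → i ≠ l → j ≠ l → A i * A j = bitSign k • A l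

/-- Nine elements of a ring that satisfy the relations of the magic square: in every row and in
every column there are three commuting involutions, with product `1` and `-1`, respectively. -/
structure IsMagicSquare (O : Fin 3 → Fin 3 → R) : Prop where
  row : ∀ x, IsParityTriple false (O x)
  col : ∀ y, IsParityTriple true fun x => O x y

theorem IsMagicSquare.anticomm {O : Fin 3 → Fin 3 → R} (h : IsMagicSquare O) {x x' y y' : Fin 3}
    (hx : x ≠ x') (hy : y ≠ y') : O x' y * O x y' = -(O x y' * O x' y) := by
  obtain ⟨x'', hx₁, hx₂⟩ := Fin.exists_ne_and_ne_of_two_lt x x' (by decide)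
  obtain ⟨y'', hy₁, hy₂⟩ := Fin.exists_ne_and_ne_of_two_lt y y' (by decide)
  have row (i : Fin 3) {j j' j'' : Fin 3} (h₁ : j ≠ j') (h₂ : j'' ≠ j) (h₃ : j'' ≠ j') :
      O i j * O i j' = O i j'' := by
    simpa [bitSign] using (h.row i).mul_of_ne h₁ h₂.symm h₃.symm
  have col (j : Fin 3) {i i' i'' : Fin 3} (h₁ : i ≠ i') (h₂ : i'' ≠ i) (h₃ : i'' ≠ i') :
      O i j * O i' j = -O i'' j := by
    simpa [bitSign] using (h.col j).mul_of_ne h₁ h₂.symm h₃.symm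
  have key : O x y * (O x' y * O x y') * O x' y' = O x y * -(O x y' * O x' y) * O x' y' := by
    calc O x y * (O x' y * O x y') * O x' y'
        = (O x y * O x' y) * (O x y' * O x' y') := by simp only [mul_assoc]
      _ = O x'' y'' := by
        rw [col y hx hx₁ hx₂, col y' hx hx₁ hx₂, neg_mul_neg, row x'' hy hy₁ hy₂]
      _ = -((O x y * O x y') * (O x' y * O x' y')) := by
        rw [row x hy hy₁ hy₂, row x' hy hy₁ hy₂, col y'' hx hx₁ hx₂, neg_neg]
      _ = O x y * -(O x y' * O x' y) * O x' y' := by simp only [mul_assoc, mul_neg, neg_mul]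
  have cancel (z : R) : O x y * (O x y * z * O x' y') * O x' y' = z := by
    simp only [← mul_assoc, (h.row x).mul_self, one_mul]
    rw [mul_assoc, (h.row x').mul_self, mul_one]
  simpa only [cancel] using congrArg (fun z => O x y * z * O x' y') key

section Trace

variable {G : Type*} [AddCommGroup G] [IsAddTorsionFree G] {tr : R →+ G}
  (htr : ∀ a b, tr (a * b) = tr (b * a))
include htr

theorem map_eq_zero_of_anticomm {p q : R} (hp : p * p = 1) (h : p * q = -(q * p)) : tr q = 0 := by
  refine self_eq_neg.mp ?_
  calc tr q = tr (p * (q * p)) := by rw [htr, mul_assoc, hp, mul_one]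
    _ = -tr q := by rw [← mul_assoc, h, neg_mul, mul_assoc, hp, mul_one, map_neg]

theorem map_mul_eq_zero_of_anticomm {p q : R} (h : p * q = -(q * p)) : tr (p * q) = 0 := by
  refine self_eq_neg.mp ?_
  rw [htr, ← map_neg, ← h, htr]

theorem IsMagicSquare.map_eq_zero {O : Fin 3 → Fin 3 → R} (h : IsMagicSquare O) (x y : Fin 3) :
    tr (O x y) = 0 := by
  obtain ⟨x', hx⟩ := exists_ne x
  obtain ⟨y', hy⟩ := exists_ne y
  exact map_eq_zero_of_anticomm htr ((h.row x').mul_self y') (h.anticomm hx.symm hy)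

theorem IsMagicSquare.map_mul {O : Fin 3 → Fin 3 → R} (h : IsMagicSquare O) (x y i j : Fin 3) :
    tr (O x j * O i y) = if i = x ∧ j = y then tr 1 else 0 := by
  by_cases hi : i = x <;> by_cases hj : j = y
  · simp [hi, hj, (h.row x).mul_self]
  · obtain ⟨l, hlj, hly⟩ := Fin.exists_ne_and_ne_of_two_lt j y (by decide)
    rw [hi, (h.row x).mul_of_ne hj hlj.symm hly.symm, map_zsmul, h.map_eq_zero htr]
    simp [hj]
  · obtain ⟨l, hlx, hli⟩ := Fin.exists_ne_and_ne_of_two_lt x i (by decide)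
    rw [hj, (h.col y).mul_of_ne (Ne.symm hi) hlx.symm hli.symm, map_zsmul, h.map_eq_zero htr]
    simp [hi]
  · rw [map_mul_eq_zero_of_anticomm htr (h.anticomm hi hj), if_neg (fun hij => hi hij.1)]

end Trace

/-- `1 + ∑ i, (-1) ^ a i • A i`. When `A` is a parity triple and `a` satisfies its parity
constraint, this is four times the projection onto the joint eigenspace with outcomes `a`. -/
def signSum (A : Fin 3 → R) (a : Fin 3 → Bool) : R := 1 + ∑ i, bitSign (a i) • A i

theorem IsParityTriple.signSum_mul {k : Bool} {A : Fin 3 → R} (hA : IsParityTriple k A)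
    {a : Fin 3 → Bool} (ha : HasParity k a) (i : Fin 3) :
    signSum A a * A i = bitSign (a i) • signSum A a := by
  obtain ⟨j, hji, -⟩ := Fin.exists_ne_and_ne_of_two_lt i i (by decide)
  obtain ⟨l, hli, hlj⟩ := Fin.exists_ne_and_ne_of_two_lt i j (by decide)
  have hsum : signSum A a =
      1 + bitSign (a i) • A i + bitSign (a j) • A j + bitSign (a l) • A l := by
    have huniv : (Finset.univ : Finset (Fin 3)) = {i, j, l} := by
      clear hA ha
      revert i j l
      decide
    rw [signSum, huniv, Finset.sum_insert (by simp [hji.symm, hli.symm]),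
      Finset.sum_pair hlj.symm]
    abel
  have hj : bitSign (a i) * bitSign (a j) = bitSign (a l) * bitSign k := by
    rw [mul_comm (bitSign (a l)), ha.bitSign_mul hji.symm hli.symm hlj.symm]
  have hl : bitSign (a i) * bitSign (a l) = bitSign (a j) * bitSign k := by
    rw [mul_comm (bitSign (a j)), ha.bitSign_mul hli.symm hji.symm hlj]
  calc signSum A a * A i
      = A i + bitSign (a i) • 1 + (bitSign (a j) * bitSign k) • A l +
          (bitSign (a l) * bitSign k) • A j := by
        simp only [hsum, add_mul, one_mul, smul_mul_assoc, hA.mul_self,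
          hA.mul_of_ne hji hlj.symm hli.symm, hA.mul_of_ne hli hlj hji.symm, smul_smul]
    _ = bitSign (a i) • signSum A a := by
        simp only [hsum, smul_add, smul_smul, bitSign_mul_self, one_smul, hj, hl]
        abel

theorem IsParityTriple.signSum_mul_self {k : Bool} {A : Fin 3 → R} (hA : IsParityTriple k A)
    {a : Fin 3 → Bool} (ha : HasParity k a) : signSum A a * signSum A a = 4 • signSum A a := by
  have hi (i : Fin 3) : signSum A a * bitSign (a i) • A i = signSum A a := by
    rw [mul_smul_comm, hA.signSum_mul ha, smul_smul, bitSign_mul_self, one_smul]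
  calc signSum A a * signSum A a
      = signSum A a * 1 + ∑ i, signSum A a * bitSign (a i) • A i := by
        rw [← Finset.mul_sum, ← mul_add, ← signSum]
    _ = 4 • signSum A a := by
        simp only [mul_one, hi, Finset.sum_const, Finset.card_univ, Fintype.card_fin]
        abel

theorem card_filter_hasParity (k : Bool) : Finset.card {a | HasParity k a} = 4 := by
  revert k
  decide

theorem sum_bitSign_eq_zero (k : Bool) (i : Fin 3) :
    ∑ a with HasParity k a, bitSign (a i) = 0 := by
  revert k i
  decide

theorem sum_signSum (k : Bool) (A : Fin 3 → R) : ∑ a with HasParity k a, signSum A a = 4 := by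
  simp only [signSum, Finset.sum_add_distrib, Finset.sum_const, card_filter_hasParity]
  rw [Finset.sum_comm]
  simp only [← Finset.sum_smul, sum_bitSign_eq_zero]
  simp

theorem IsMagicSquare.map_signSum {G : Type*} [AddCommGroup G] [IsAddTorsionFree G] {tr : R →+ G}
    (htr : ∀ a b, tr (a * b) = tr (b * a)) {O : Fin 3 → Fin 3 → R} (h : IsMagicSquare O)
    (x : Fin 3) (a : Fin 3 → Bool) : tr (signSum (O x) a) = tr 1 := by
  simp only [signSum, map_add, map_sum, map_zsmul, h.map_eq_zero htr, smul_zero,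
    Finset.sum_const_zero, add_zero]

theorem IsMagicSquare.map_signSum_mul_signSum {G : Type*} [AddCommGroup G] [IsAddTorsionFree G]
    {tr : R →+ G} (htr : ∀ a b, tr (a * b) = tr (b * a)) {O : Fin 3 → Fin 3 → R}
    (h : IsMagicSquare O) (x y : Fin 3) (a b : Fin 3 → Bool) :
    tr (signSum (O x) a * signSum (fun i => O i y) b) =
      (1 + bitSign (a y) * bitSign (b x)) • tr 1 := by
  simp only [signSum, add_mul, mul_add, one_mul, mul_one, Finset.sum_mul, Finset.mul_sum,
    smul_mul_smul_comm, map_add, map_sum, map_zsmul, h.map_eq_zero htr, h.map_mul htr]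
  simp [ite_and, add_smul]

section Observable

variable {α β : Type*} {M : α → R} {N : β → R} {f : α → Bool} {g : β → Bool}

/-- The `±1`-valued observable for the bit `f` of the outcome of the measurement `M`. -/
def observable [Fintype α] (M : α → R) (f : α → Bool) : R := ∑ a, bitSign (f a) • M a

theorem mul_observable [Fintype β] (hN : ∑ b, N b = 1)
    (h : ∀ a b, f a ≠ g b → M a * N b = 0) (a : α) :
    M a * observable N g = bitSign (f a) • M a := by
  calc M a * observable N g = ∑ b, bitSign (g b) • (M a * N b) := by
        simp only [observable, Finset.mul_sum, mul_smul_comm]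
    _ = ∑ b, bitSign (f a) • (M a * N b) := by
        refine Finset.sum_congr rfl fun b _ => ?_
        by_cases hab : f a = g b
        · rw [hab]
        · rw [h a b hab, smul_zero, smul_zero]
    _ = bitSign (f a) • M a := by rw [← Finset.smul_sum, ← Finset.mul_sum, hN, mul_one]

theorem observable_eq_observable [Fintype α] [Fintype β] (hM : ∑ a, M a = 1)
    (hN : ∑ b, N b = 1) (h : ∀ a b, f a ≠ g b → M a * N b = 0) :
    observable M f = observable N g := by
  calc observable M f = ∑ a, M a * observable N g := by
        simp only [mul_observable hN h]
        rfl
    _ = observable N g := by rw [← Finset.sum_mul, hM, one_mul]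

theorem observable_mul [Fintype α] (hM : ∑ a, M a = 1) (h : ∀ a b, f a ≠ g b → M a * N b = 0)
    (b : β) : observable M f * N b = bitSign (g b) • N b := by
  calc observable M f * N b = ∑ a, bitSign (f a) • (M a * N b) := by
        simp only [observable, Finset.sum_mul, smul_mul_assoc]
    _ = ∑ a, bitSign (g b) • (M a * N b) := by
        refine Finset.sum_congr rfl fun a _ => ?_
        by_cases hab : f a = g b
        · rw [hab]
        · rw [h a b hab, smul_zero, smul_zero]
    _ = bitSign (g b) • N b := by rw [← Finset.smul_sum, ← Finset.sum_mul, hM, one_mul]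

end Observable

theorem isParityTriple_of_forall_mul_eq {k : Bool} {M : (Fin 3 → Bool) → R} {A : Fin 3 → R}
    (hM : ∑ a, M a = 1) (hk : ∀ a, ¬ HasParity k a → M a = 0)
    (h : ∀ a i, M a * A i = bitSign (a i) • M a) : IsParityTriple k A := by
  have ext {z w : R} (hzw : ∀ a, HasParity k a → M a * z = M a * w) : z = w := by
    rw [← one_mul z, ← one_mul w, ← hM, Finset.sum_mul, Finset.sum_mul]
    refine Finset.sum_congr rfl fun a _ => ?_
    by_cases ha : HasParity k a
    · exact hzw a ha
    · rw [hk a ha, zero_mul, zero_mul]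
  have mul_mul (a : Fin 3 → Bool) (i j : Fin 3) :
      M a * (A i * A j) = (bitSign (a i) * bitSign (a j)) • M a := by
    rw [← mul_assoc, h, smul_mul_assoc, h, smul_smul]
  refine ⟨fun i => ext fun a _ => ?_, fun {i j l} hij hil hjl => ext fun a ha => ?_⟩
  · rw [mul_mul, bitSign_mul_self, one_smul, mul_one]
  · rw [mul_mul, ha.bitSign_mul hij hil hjl, mul_smul_comm, h, smul_smul]

theorem IsParityTriple.unop {k : Bool} {A : Fin 3 → Rᵐᵒᵖ} (hA : IsParityTriple k A) :
    IsParityTriple k fun i => (A i).unop where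
  mul_self i := by rw [← MulOpposite.unop_mul, hA.mul_self, MulOpposite.unop_one]
  mul_of_ne hij hil hjl := by
    rw [← MulOpposite.unop_mul, hA.mul_of_ne hij.symm hjl hil, MulOpposite.unop_smul]

theorem isMagicSquare_of_mul_eq_zero {M N : Fin 3 → (Fin 3 → Bool) → R}
    (hM : ∀ x, ∑ a, M x a = 1) (hN : ∀ y, ∑ b, N y b = 1)
    (h : ∀ x y a b, ¬ magicSquareGame.rel x y a b → M x a * N y b = 0) :
    IsMagicSquare fun x y => observable (M x) (fun a => a y) := by
  simp only [magicSquareGame_rel_iff] at h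
  have hne (x y : Fin 3) (a b : Fin 3 → Bool) (hab : a y ≠ b x) : M x a * N y b = 0 :=
    h x y a b fun hwin => hab hwin.2.2
  have hobs (x y : Fin 3) : observable (M x) (fun a => a y) = observable (N y) (fun b => b x) :=
    observable_eq_observable (hM x) (hN y) (hne x y)
  refine ⟨fun x => ?_, fun y => ?_⟩
  · refine isParityTriple_of_forall_mul_eq (hM x) (fun a ha => ?_) fun a y => ?_
    · rw [← mul_one (M x a), ← hN 0, Finset.mul_sum]
      exact Finset.sum_eq_zero fun b _ => h x 0 a b fun hwin => ha hwin.1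
    · rw [hobs]
      exact mul_observable (hN y) (hne x y) a
  · refine IsParityTriple.unop (A := fun x => .op (observable (M x) fun a => a y))
      (isParityTriple_of_forall_mul_eq (M := fun b => .op (N y b)) ?_ (fun b hb => ?_)
        fun b x => ?_)
    · rw [← Finset.op_sum, hN, MulOpposite.op_one]
    · rw [← one_mul (N y b), ← hM 0, Finset.sum_mul, MulOpposite.op_eq_zero_iff]
      exact Finset.sum_eq_zero fun a _ => h 0 y a b fun hwin => hb hwin.2.1
    · rw [← MulOpposite.op_mul, observable_mul (hM x) (hne x y), MulOpposite.op_smul]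

end Ring

section Rank

open Module

variable {K V W : Type*} [Field K] [CharZero K] [AddCommGroup V] [Module K V]
  [FiniteDimensional K V] [AddCommGroup W] [Module K W]

theorem IsMagicSquare.four_dvd_finrank {O : Fin 3 → Fin 3 → End K V} (h : IsMagicSquare O) :
    4 ∣ finrank K V := by
  have four_ne : (4 : K) ≠ 0 := OfNat.ofNat_ne_zero 4
  let a₀ : Fin 3 → Bool := fun _ => false
  let P : End K V := (4⁻¹ : K) • signSum (O 0) a₀
  have hP : IsIdempotentElem P := by
    have hsq : signSum (O 0) a₀ * signSum (O 0) a₀ = (4 : K) • signSum (O 0) a₀ := by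
      rw [(h.row 0).signSum_mul_self (by decide)]
      exact (ofNat_smul_eq_nsmul K 4 _).symm
    rw [IsIdempotentElem, smul_mul_smul_comm, hsq, smul_smul, mul_assoc,
      inv_mul_cancel₀ four_ne, mul_one]
  have htrace : LinearMap.trace K V P = 4⁻¹ * finrank K V := by
    have h₁ := h.map_signSum (tr := (LinearMap.trace K V).toAddMonoidHom)
      (LinearMap.trace_mul_comm K) 0 a₀
    simp only [LinearMap.toAddMonoidHom_coe, LinearMap.trace_one] at h₁
    rw [map_smul, h₁, smul_eq_mul]
  rw [(LinearMap.IsIdempotentElem.isProj_range P hP).trace,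
    eq_inv_mul_iff_mul_eq₀ four_ne] at htrace
  exact ⟨_, by exact_mod_cast htrace.symm⟩

theorem sum_comp_comp {R ι V₁ V₂ V₃ V₄ : Type*} [CommSemiring R] [Fintype ι]
    [AddCommMonoid V₁] [Module R V₁] [AddCommMonoid V₂] [Module R V₂]
    [AddCommMonoid V₃] [Module R V₃] [AddCommMonoid V₄] [Module R V₄]
    (g : V₃ →ₗ[R] V₄) (f : ι → V₂ →ₗ[R] V₃) (e : V₁ →ₗ[R] V₂) :
    ∑ i, g ∘ₗ f i ∘ₗ e = g ∘ₗ (∑ i, f i) ∘ₗ e := by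
  ext v
  simp only [LinearMap.sum_apply, LinearMap.comp_apply, map_sum]

theorem four_dvd_finrank_range {M : Fin 3 → (Fin 3 → Bool) → End K W}
    {N : Fin 3 → (Fin 3 → Bool) → End K V} (hM : ∀ x, ∑ a, M x a = 1) (hN : ∀ y, ∑ b, N y b = 1)
    (f : V →ₗ[K] W) (h : ∀ x y a b, ¬ magicSquareGame.rel x y a b → M x a ∘ₗ f ∘ₗ N y b = 0) :
    4 ∣ finrank K (LinearMap.range f) := by
  obtain ⟨L, hL⟩ := f.range.subtype.exists_leftInverse_of_injective f.range.ker_subtype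
  obtain ⟨S, hS⟩ := f.rangeRestrict.exists_rightInverse_of_surjective f.range_rangeRestrict
  refine (isMagicSquare_of_mul_eq_zero (M := fun x a => L ∘ₗ M x a ∘ₗ f.range.subtype)
    (N := fun y b => f.rangeRestrict ∘ₗ N y b ∘ₗ S) (fun x => ?_) (fun y => ?_)
    fun x y a b hab => ?_).four_dvd_finrank
  · rw [sum_comp_comp, hM]
    exact hL
  · rw [sum_comp_comp, hN]
    exact hS
  · calc (L ∘ₗ M x a ∘ₗ f.range.subtype) * (f.rangeRestrict ∘ₗ N y b ∘ₗ S)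
        = L ∘ₗ (M x a ∘ₗ f ∘ₗ N y b) ∘ₗ S := rfl
      _ = 0 := by rw [h x y a b hab, LinearMap.zero_comp, LinearMap.comp_zero]

theorem four_dvd_rank {m n : Type*} [Fintype m] [DecidableEq m] [Fintype n] [DecidableEq n]
    {M : Fin 3 → (Fin 3 → Bool) → Matrix m m K} {N : Fin 3 → (Fin 3 → Bool) → Matrix n n K}
    (hM : ∀ x, ∑ a, M x a = 1) (hN : ∀ y, ∑ b, N y b = 1) (A : Matrix m n K)
    (h : ∀ x y a b, ¬ magicSquareGame.rel x y a b → M x a * A * N y b = 0) : 4 ∣ A.rank := by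
  refine four_dvd_finrank_range (M := fun x a => (M x a).toLin') (N := fun y b => (N y b).toLin')
    (fun x => ?_) (fun y => ?_) A.toLin' fun x y a b hab => ?_
  · rw [← map_sum, hM, Matrix.toLin'_one, Module.End.one_eq_id]
  · rw [← map_sum, hN, Matrix.toLin'_one, Module.End.one_eq_id]
  · rw [← Matrix.toLin'_mul, ← Matrix.toLin'_mul, ← Matrix.mul_assoc, h x y a b hab, map_zero]

end Rank

/-! ### States and the Born rule -/

section CoeffMatrix

variable {m n : Type*}

/-- The matrix `Ψ` of coefficients of a bipartite state `ψ = ∑ i j, Ψ i j |i j⟩`. Local operators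
act on it by multiplication from the left and, transposed, from the right. -/
def coeffMatrix (ψ : m × n → ℂ) : Matrix m n ℂ := Matrix.of (Function.curry ψ)

theorem vec_transpose_coeffMatrix (ψ : m × n → ℂ) : (coeffMatrix ψ)ᵀ.vec = ψ := rfl

/-- The Schmidt rank of a bipartite state. -/
noncomputable def schmidtRank [Fintype n] (ψ : m × n → ℂ) : ℕ := (coeffMatrix ψ).rank

theorem schmidtRank_le_card [Fintype n] (ψ : m × n → ℂ) : schmidtRank ψ ≤ Fintype.card n :=
  (coeffMatrix ψ).rank_le_card_width

theorem schmidtRank_pos [Fintype n] {ψ : m × n → ℂ} (hψ : ψ ≠ 0) : 0 < schmidtRank ψ := by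
  refine Nat.pos_of_ne_zero fun h => hψ ?_
  classical
  rw [schmidtRank, Matrix.rank, Submodule.finrank_eq_zero, LinearMap.range_eq_bot,
    ← Matrix.toLin'_apply', map_eq_zero_iff _ Matrix.toLin'.injective] at h
  rw [← vec_transpose_coeffMatrix ψ, h, Matrix.transpose_zero, Matrix.vec_zero]

variable [Fintype m] [Fintype n]

theorem kronecker_mulVec_eq_vec (ψ : m × n → ℂ) (E : Matrix m m ℂ) (F : Matrix n n ℂ) :
    (E ⊗ₖ F) *ᵥ ψ = (E * coeffMatrix ψ * Fᵀ)ᵀ.vec := by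
  rw [← vec_transpose_coeffMatrix ψ, Matrix.kronecker_mulVec_vec, vec_transpose_coeffMatrix,
    Matrix.transpose_mul, Matrix.transpose_mul, Matrix.transpose_transpose, Matrix.mul_assoc]

end CoeffMatrix

section Born

variable {m n : Type} [Fintype m] [Fintype n]

theorem bornProb_eq_re_trace (ψ : m × n → ℂ) (E : Matrix m m ℂ) (F : Matrix n n ℂ) :
    bornProb ψ E F = (E * coeffMatrix ψ * Fᵀ * (coeffMatrix ψ)ᴴ).trace.re := by
  rw [bornProb, kronecker_mulVec_eq_vec]
  nth_rewrite 1 [← vec_transpose_coeffMatrix ψ]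
  rw [Matrix.star_vec_dotProduct_vec, ← Matrix.trace_transpose, Matrix.transpose_mul,
    Matrix.transpose_transpose, Matrix.conjTranspose_transpose]
  rfl

theorem bornProb_nonneg (ψ : m × n → ℂ) {E : Matrix m m ℂ} {F : Matrix n n ℂ}
    (hE : E.PosSemidef) (hF : F.PosSemidef) : 0 ≤ bornProb ψ E F :=
  (hE.kronecker hF).re_dotProduct_nonneg ψ

theorem mul_coeffMatrix_mul_eq_zero_of_bornProb_eq_zero {ψ : m × n → ℂ} {E : Matrix m m ℂ}
    {F : Matrix n n ℂ} (hE : E.PosSemidef) (hF : F.PosSemidef) (h : bornProb ψ E F = 0) :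
    E * coeffMatrix ψ * Fᵀ = 0 := by
  have hEF := hE.kronecker hF
  have hinner : star ψ ⬝ᵥ ((E ⊗ₖ F) *ᵥ ψ) = 0 :=
    Complex.ext h (Complex.le_def.mp (hEF.dotProduct_mulVec_nonneg ψ)).2.symm
  have hvec := (hEF.dotProduct_mulVec_zero_iff ψ).mp hinner
  rw [kronecker_mulVec_eq_vec] at hvec
  exact Matrix.transpose_eq_zero.mp (Matrix.vec_eq_zero_iff.mp hvec)

theorem measurable_bornProb {Ω : Type*} [MeasurableSpace Ω] (ψ : m × n → ℂ)
    {E : Ω → Matrix m m ℂ} {F : Ω → Matrix n n ℂ} (hE : ∀ i j, Measurable fun ω => E ω i j)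
    (hF : ∀ i j, Measurable fun ω => F ω i j) : Measurable fun ω => bornProb ψ (E ω) (F ω) := by
  simp only [bornProb, dotProduct, Matrix.mulVec, Matrix.kroneckerMap_apply]
  fun_prop

variable [DecidableEq m] [DecidableEq n] {YA YB : Type} [Fintype YA] [Fintype YB]

theorem sum_bornProb (ψ : m × n → ℂ) (M : POVM m YA) (N : POVM n YB) :
    ∑ a, ∑ b, bornProb ψ (M.effect a) (N.effect b) = (star ψ ⬝ᵥ ψ).re := by
  have hsum : ∑ a, ∑ b, M.effect a ⊗ₖ N.effect b = 1 := by
    rw [← Matrix.one_kronecker_one, ← M.sum_eq_one, ← N.sum_eq_one]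
    ext i j
    simp only [Matrix.sum_apply, Matrix.kroneckerMap_apply, Finset.sum_mul_sum]
  simp only [bornProb, ← Complex.re_sum, ← dotProduct_sum, ← Matrix.sum_mulVec, hsum,
    Matrix.one_mulVec]

theorem bornProb_le (ψ : m × n → ℂ) (M : POVM m YA) (N : POVM n YB) (a : YA) (b : YB) :
    bornProb ψ (M.effect a) (N.effect b) ≤ (star ψ ⬝ᵥ ψ).re := by
  have hnonneg (a : YA) (b : YB) : 0 ≤ bornProb ψ (M.effect a) (N.effect b) :=
    bornProb_nonneg ψ (M.posSemidef a) (N.posSemidef b)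
  calc bornProb ψ (M.effect a) (N.effect b)
      ≤ ∑ b, bornProb ψ (M.effect a) (N.effect b) :=
        Finset.single_le_sum (fun b _ => hnonneg a b) (Finset.mem_univ b)
    _ ≤ ∑ a, ∑ b, bornProb ψ (M.effect a) (N.effect b) :=
        Finset.single_le_sum (f := fun a => ∑ b, bornProb ψ (M.effect a) (N.effect b))
          (fun a _ => Finset.sum_nonneg fun b _ => hnonneg a b) (Finset.mem_univ a)
    _ = (star ψ ⬝ᵥ ψ).re := sum_bornProb ψ M N

open MeasureTheory

theorem integrable_bornProb {Ω : Type*} [MeasurableSpace Ω] {μ : Measure Ω} [IsFiniteMeasure μ]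
    (ψ : m × n → ℂ) {M : Ω → POVM m YA} {N : Ω → POVM n YB}
    (hM : ∀ a i j, Measurable fun ω => (M ω).effect a i j)
    (hN : ∀ b i j, Measurable fun ω => (N ω).effect b i j) (a : YA) (b : YB) :
    Integrable (fun ω => bornProb ψ ((M ω).effect a) ((N ω).effect b)) μ := by
  refine .of_bound (measurable_bornProb ψ (hM a) (hN b)).aestronglyMeasurable
    (star ψ ⬝ᵥ ψ).re (.of_forall fun ω => ?_)
  rw [Real.norm_eq_abs, abs_of_nonneg
    (bornProb_nonneg ψ ((M ω).posSemidef a) ((N ω).posSemidef b))]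
  exact bornProb_le ψ (M ω) (N ω) a b

variable {XA XB : Type} {ψ : m × n → ℂ} {q : Correlation XA XB YA YB}

theorem IsQuantumWithSharedRandomness.nonneg (hq : IsQuantumWithSharedRandomness ψ q)
    (x : XA) (y : XB) (a : YA) (b : YB) : 0 ≤ q x y a b := by
  obtain ⟨Ω, _, μ, _, M, N, -, -, hMN⟩ := hq
  rw [hMN]
  exact integral_nonneg fun ω => bornProb_nonneg ψ ((M ω x).posSemidef a) ((N ω y).posSemidef b)

theorem IsQuantumWithSharedRandomness.sum_eq (hq : IsQuantumWithSharedRandomness ψ q)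
    (x : XA) (y : XB) : ∑ a, ∑ b, q x y a b = (star ψ ⬝ᵥ ψ).re := by
  obtain ⟨Ω, _, μ, _, M, N, hM, hN, hMN⟩ := hq
  have hint (a : YA) (b : YB) :
      Integrable (fun ω => bornProb ψ ((M ω x).effect a) ((N ω y).effect b)) μ :=
    integrable_bornProb ψ (hM x) (hN y) a b
  calc ∑ a, ∑ b, q x y a b
      = ∫ ω, ∑ a, ∑ b, bornProb ψ ((M ω x).effect a) ((N ω y).effect b) ∂μ := by
        rw [integral_finsetSum _ fun a _ => integrable_finsetSum _ fun b _ => hint a b]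
        refine Finset.sum_congr rfl fun a _ => ?_
        rw [integral_finsetSum _ fun b _ => hint a b]
        exact Finset.sum_congr rfl fun b _ => hMN x y a b
    _ = (star ψ ⬝ᵥ ψ).re := by simp [sum_bornProb]

theorem IsQuantumWithSharedRandomness.exists_mul_eq_zero [Finite XA] [Finite XB]
    (hq : IsQuantumWithSharedRandomness ψ q) :
    ∃ (M : XA → POVM m YA) (N : XB → POVM n YB), ∀ x y a b, q x y a b = 0 →
      (M x).effect a * coeffMatrix ψ * ((N y).effect b)ᵀ = 0 := by
  obtain ⟨Ω, _, μ, _, M, N, hM, hN, hMN⟩ := hq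
  have hae (x : XA) (y : XB) (a : YA) (b : YB) : ∀ᵐ ω ∂μ, q x y a b = 0 →
      bornProb ψ ((M ω x).effect a) ((N ω y).effect b) = 0 := by
    by_cases h : q x y a b = 0
    · rw [hMN, integral_eq_zero_iff_of_nonneg
        (fun ω => bornProb_nonneg ψ ((M ω x).posSemidef a) ((N ω y).posSemidef b))
        (integrable_bornProb ψ (hM x) (hN y) a b)] at h
      filter_upwards [h] with ω hω _ using hω
    · exact .of_forall fun ω hω => absurd hω h
  obtain ⟨ω, hω⟩ := (ae_all_iff.mpr fun x => ae_all_iff.mpr fun y => ae_all_iff.mpr fun a =>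
    ae_all_iff.mpr fun b => hae x y a b).exists
  exact ⟨M ω, N ω, fun x y a b h => mul_coeffMatrix_mul_eq_zero_of_bornProb_eq_zero
    ((M ω x).posSemidef a) ((N ω y).posSemidef b) (hω x y a b h)⟩

theorem four_dvd_schmidtRank_of_isWonBy (hψ : star ψ ⬝ᵥ ψ = 1)
    {q : Correlation (Fin 3) (Fin 3) (Fin 3 → Bool) (Fin 3 → Bool)}
    (hq : IsQuantumWithSharedRandomness ψ q) (hwin : magicSquareGame.IsWonBy q) :
    4 ∣ schmidtRank ψ := by
  have hnorm : (star ψ ⬝ᵥ ψ).re = 1 := by rw [hψ, Complex.one_re]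
  obtain ⟨M, N, hMN⟩ := hq.exists_mul_eq_zero
  refine four_dvd_rank (fun x => (M x).sum_eq_one) (N := fun y b => ((N y).effect b)ᵀ)
    (fun y => ?_) _ fun x y a b hab => hMN x y a b
      (hwin.eq_zero_of_not_rel hq.nonneg (fun x y => hnorm ▸ hq.sum_eq x y) hab)
  rw [← Matrix.transpose_sum, (N y).sum_eq_one, Matrix.transpose_one]

end Born

theorem star_qubitPair_dotProduct {α β : ℂ} (h : ‖α‖ ^ 2 + ‖β‖ ^ 2 = 1) :
    star (qubitPair α β) ⬝ᵥ qubitPair α β = 1 := by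
  rw [← Complex.ofReal_one, ← h]
  simp [dotProduct, Fintype.sum_prod_type, qubitPair, Pi.single_apply, Complex.conj_mul']

theorem not_four_dvd_schmidtRank_qubitPair {α β : ℂ} (h : ‖α‖ ^ 2 + ‖β‖ ^ 2 = 1) :
    ¬ 4 ∣ schmidtRank (qubitPair α β) := by
  have hne : qubitPair α β ≠ 0 := fun h₀ => by simpa [h₀] using star_qubitPair_dotProduct h
  exact Nat.not_dvd_of_pos_of_lt (schmidtRank_pos hne)
    ((schmidtRank_le_card _).trans_lt (by decide))

/-! ### Strategies on maximally entangled states -/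

section MaximallyEntangled

variable {n : Type} [Fintype n] [DecidableEq n]

theorem isHermitian_signSum {A : Fin 3 → Matrix n n ℂ} (hA : ∀ i, (A i).IsHermitian)
    (a : Fin 3 → Bool) : (signSum A a).IsHermitian := by
  refine Matrix.isHermitian_one.add ?_
  rw [Matrix.IsHermitian, Matrix.conjTranspose_sum]
  exact Finset.sum_congr rfl fun i _ => by rw [Matrix.conjTranspose_smul, (hA i).eq, star_trivial]

theorem IsParityTriple.posSemidef_signSum {k : Bool} {A : Fin 3 → Matrix n n ℂ}
    (hA : IsParityTriple k A) (hAh : ∀ i, (A i).IsHermitian) {a : Fin 3 → Bool}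
    (ha : HasParity k a) : ((4⁻¹ : ℂ) • signSum A a).PosSemidef := by
  have hsq : (4⁻¹ : ℂ) • signSum A a =
      (16⁻¹ : ℂ) • ((signSum A a)ᴴ * signSum A a) := by
    rw [(isHermitian_signSum hAh a).eq, hA.signSum_mul_self ha, ← ofNat_smul_eq_nsmul ℂ, smul_smul]
    norm_num
  rw [hsq]
  exact (Matrix.posSemidef_conjTranspose_mul_self _).smul (by positivity)

/-- The joint measurement of a parity triple of Hermitian matrices. -/
noncomputable def IsParityTriple.povm {k : Bool} {A : Fin 3 → Matrix n n ℂ}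
    (hA : IsParityTriple k A) (hAh : ∀ i, (A i).IsHermitian) : POVM n (Fin 3 → Bool) where
  effect a := if HasParity k a then (4⁻¹ : ℂ) • signSum A a else 0
  posSemidef a := by
    split_ifs with ha
    exacts [hA.posSemidef_signSum hAh ha, .zero]
  sum_eq_one := by
    rw [← Finset.sum_filter, ← Finset.smul_sum, sum_signSum,
      ← map_ofNat (algebraMap ℂ (Matrix n n ℂ)) 4, Algebra.algebraMap_eq_smul_one, smul_smul]
    norm_num

/-- The bipartite states `ψ` on `ℂ^n ⊗ ℂ^n` whose reduced state on the first factor, which is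
`Ψ * Ψᴴ` for the coefficient matrix `Ψ`, is completely mixed. -/
def IsMaximallyEntangled (ψ : n × n → ℂ) : Prop :=
  coeffMatrix ψ * (coeffMatrix ψ)ᴴ = (Fintype.card n : ℂ)⁻¹ • 1

variable [Nonempty n] {ψ : n × n → ℂ}

theorem IsMaximallyEntangled.card_smul_conjTranspose_mul (hψ : IsMaximallyEntangled ψ) :
    (Fintype.card n : ℂ) • ((coeffMatrix ψ)ᴴ * coeffMatrix ψ) = 1 := by
  rw [← smul_mul_assoc, mul_eq_one_comm, mul_smul_comm, hψ, smul_smul,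
    mul_inv_cancel₀ (Nat.cast_ne_zero.mpr Fintype.card_ne_zero), one_smul]

/-- Bob's measurement on a maximally entangled state whose outcome is that of the measurement `M`
by Alice, with certainty if `M` is projective. -/
noncomputable def POVM.mirror {Y : Type} [Fintype Y] (M : POVM n Y)
    (hψ : IsMaximallyEntangled ψ) : POVM n Y where
  effect a := (Fintype.card n : ℂ) • ((coeffMatrix ψ)ᴴ * M.effect a * coeffMatrix ψ)ᵀ
  posSemidef a :=
    ((M.posSemidef a).conjTranspose_mul_mul_same (coeffMatrix ψ)).transpose.smul (by positivity)
  sum_eq_one := by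
    rw [← Finset.smul_sum, ← Matrix.transpose_sum, ← Finset.sum_mul, ← Finset.mul_sum,
      M.sum_eq_one, mul_one, ← Matrix.transpose_smul, hψ.card_smul_conjTranspose_mul,
      Matrix.transpose_one]

theorem bornProb_mirror {YA YB : Type} [Fintype YA] [Fintype YB] (M : POVM n YA) (N : POVM n YB)
    (hψ : IsMaximallyEntangled ψ) (a : YA) (b : YB) :
    bornProb ψ (M.effect a) ((N.mirror hψ).effect b) =
      (M.effect a * N.effect b).trace.re / Fintype.card n := by
  have hcard : (Fintype.card n : ℂ) ≠ 0 := Nat.cast_ne_zero.mpr Fintype.card_ne_zero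
  have hprod : M.effect a * coeffMatrix ψ * ((N.mirror hψ).effect b)ᵀ * (coeffMatrix ψ)ᴴ =
      (Fintype.card n : ℂ)⁻¹ • (M.effect a * N.effect b) := by
    calc M.effect a * coeffMatrix ψ * ((N.mirror hψ).effect b)ᵀ * (coeffMatrix ψ)ᴴ
        = (Fintype.card n : ℂ) • (M.effect a * (coeffMatrix ψ * (coeffMatrix ψ)ᴴ) * N.effect b *
            (coeffMatrix ψ * (coeffMatrix ψ)ᴴ)) := by
          simp only [POVM.mirror, Matrix.transpose_smul, Matrix.transpose_transpose,
            mul_smul_comm, smul_mul_assoc, mul_assoc]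
      _ = (Fintype.card n : ℂ)⁻¹ • (M.effect a * N.effect b) := by
          rw [hψ]
          simp only [mul_smul_comm, smul_mul_assoc, mul_one, smul_smul]
          rw [mul_inv_cancel_left₀ hcard]
  rw [bornProb_eq_re_trace, hprod, Matrix.trace_smul, smul_eq_mul,
    ← div_eq_inv_mul, Complex.div_natCast_re]

theorem IsMagicSquare.isQuantum {O : Fin 3 → Fin 3 → Matrix n n ℂ} (h : IsMagicSquare O)
    (hO : ∀ x y, (O x y).IsHermitian) (hψ : IsMaximallyEntangled ψ) :
    IsQuantum ψ magicSquareCorrelation := by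
  refine ⟨fun x => (h.row x).povm (hO x),
    fun y => ((h.col y).povm fun x => hO x y).mirror hψ, fun x y a b => ?_⟩
  have hcard : (Fintype.card n : ℝ) ≠ 0 := Nat.cast_ne_zero.mpr Fintype.card_ne_zero
  simp only [bornProb_mirror, magicSquareCorrelation_apply, magicSquareGame_rel_iff]
  by_cases ha : HasParity false a
  · by_cases hb : HasParity true b
    · have htrace := h.map_signSum_mul_signSum (tr := Matrix.traceAddMonoidHom n ℂ)
        Matrix.trace_mul_comm x y a b
      simp only [Matrix.traceAddMonoidHom_apply, Matrix.trace_one] at htrace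
      simp only [IsParityTriple.povm, ha, hb, if_true, true_and, smul_mul_smul_comm,
        Matrix.trace_smul, htrace]
      have hsign : 1 + bitSign (a y) * bitSign (b x) = if a y = b x then 2 else 0 := by
        cases a y <;> cases b x <;> rfl
      rw [hsign]
      split_ifs
      · have hval : (4⁻¹ * 4⁻¹ : ℂ) • (2 : ℤ) • (Fintype.card n : ℂ) =
            ((Fintype.card n / 8 : ℝ) : ℂ) := by
          push_cast [zsmul_eq_mul, smul_eq_mul]
          ring
        rw [hval, Complex.ofReal_re]
        field_simp
      · simp
    · simp [IsParityTriple.povm, hb]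
  · simp [IsParityTriple.povm, ha]

end MaximallyEntangled

section Kronecker

variable {l m n p R : Type*} [Mul R] [HasDistribNeg R]

theorem neg_kronecker (A : Matrix l m R) (B : Matrix n p R) : (-A) ⊗ₖ B = -(A ⊗ₖ B) :=
  Matrix.ext fun _ _ => neg_mul _ _

theorem kronecker_neg (A : Matrix l m R) (B : Matrix n p R) : A ⊗ₖ (-B) = -(A ⊗ₖ B) :=
  Matrix.ext fun _ _ => mul_neg _ _

end Kronecker

section Pauli

/-- The Pauli matrix `X`. -/
def pauliX : Matrix (Fin 2) (Fin 2) ℂ := !![0, 1; 1, 0]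

/-- The Pauli matrix `Z`. -/
def pauliZ : Matrix (Fin 2) (Fin 2) ℂ := !![1, 0; 0, -1]

/-- `i` times the Pauli matrix `Y`, which makes it real. -/
def pauliIY : Matrix (Fin 2) (Fin 2) ℂ := !![0, 1; -1, 0]

/-- Mermin's magic square of two-qubit observables, with `Y ⊗ Y` written as
`-(pauliIY ⊗ₖ pauliIY)`. -/
def merminSquare : Fin 3 → Fin 3 → Matrix (Fin 2 × Fin 2) (Fin 2 × Fin 2) ℂ :=
  ![![pauliX ⊗ₖ 1, 1 ⊗ₖ pauliX, pauliX ⊗ₖ pauliX],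
    ![1 ⊗ₖ pauliZ, pauliZ ⊗ₖ 1, pauliZ ⊗ₖ pauliZ],
    ![-(pauliX ⊗ₖ pauliZ), -(pauliZ ⊗ₖ pauliX), -(pauliIY ⊗ₖ pauliIY)]]

theorem pauli_mul :
    pauliX * pauliX = 1 ∧ pauliZ * pauliZ = 1 ∧ pauliIY * pauliIY = -1 ∧
    pauliX * pauliZ = -pauliIY ∧ pauliZ * pauliX = pauliIY ∧
    pauliX * pauliIY = -pauliZ ∧ pauliIY * pauliX = pauliZ ∧
    pauliZ * pauliIY = pauliX ∧ pauliIY * pauliZ = -pauliX := by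
  refine ⟨?_, ?_, ?_, ?_, ?_, ?_, ?_, ?_, ?_⟩ <;>
    simp [pauliX, pauliZ, pauliIY, Matrix.one_fin_two]

theorem merminSquare_mul_self (x y : Fin 3) : merminSquare x y * merminSquare x y = 1 := by
  fin_cases x <;> fin_cases y <;>
    simp [merminSquare, ← Matrix.mul_kronecker_mul, pauli_mul, neg_kronecker, kronecker_neg]

theorem isMagicSquare_merminSquare : IsMagicSquare merminSquare where
  row x := by
    refine ⟨merminSquare_mul_self x, fun {i j l} hij hil hjl => ?_⟩
    fin_cases x <;> fin_cases i <;> fin_cases j <;> fin_cases l <;>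
      simp [merminSquare, ← Matrix.mul_kronecker_mul, pauli_mul, neg_kronecker, kronecker_neg,
        bitSign] at hij hil hjl ⊢
  col y := by
    refine ⟨fun x => merminSquare_mul_self x y, fun {i j l} hij hil hjl => ?_⟩
    fin_cases y <;> fin_cases i <;> fin_cases j <;> fin_cases l <;>
      simp [merminSquare, ← Matrix.mul_kronecker_mul, pauli_mul, neg_kronecker, kronecker_neg,
        bitSign] at hij hil hjl ⊢

theorem conjTranspose_pauliX : pauliXᴴ = pauliX := by
  ext i j
  fin_cases i <;> fin_cases j <;> simp [pauliX]

theorem conjTranspose_pauliZ : pauliZᴴ = pauliZ := by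
  ext i j
  fin_cases i <;> fin_cases j <;> simp [pauliZ]

theorem conjTranspose_pauliIY : pauliIYᴴ = -pauliIY := by
  ext i j
  fin_cases i <;> fin_cases j <;> simp [pauliIY]

theorem isHermitian_merminSquare (x y : Fin 3) : (merminSquare x y).IsHermitian := by
  fin_cases x <;> fin_cases y <;>
    simp [Matrix.IsHermitian, merminSquare, Matrix.conjTranspose_kronecker, conjTranspose_pauliX,
      conjTranspose_pauliZ, conjTranspose_pauliIY, neg_kronecker, kronecker_neg]

theorem coeffMatrix_magicState :
    coeffMatrix magicState = (1 / 2 : ℂ) • (pauliIY ⊗ₖ pauliIY) := by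
  ext ⟨i, j⟩ ⟨k, l⟩
  fin_cases i <;> fin_cases j <;> fin_cases k <;> fin_cases l <;>
    simp [coeffMatrix, magicState, ket4, pauliIY, Function.curry]

theorem isMaximallyEntangled_magicState : IsMaximallyEntangled magicState := by
  have hY : pauliIY * pauliIYᴴ = 1 := by simp [conjTranspose_pauliIY, pauli_mul]
  rw [IsMaximallyEntangled, coeffMatrix_magicState, Matrix.conjTranspose_smul,
    Matrix.conjTranspose_kronecker, smul_mul_smul_comm, ← Matrix.mul_kronecker_mul, hY,
    Matrix.one_kronecker_one]
  congr 1
  norm_num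

end Pauli

theorem mainTheorem11_general :
    magicSquareGame.IsWonBy magicSquareCorrelation ∧
    IsQuantum magicState magicSquareCorrelation ∧
    (∃ P : NLBProtocol (Fin 3) (Fin 3) (Fin 3 → Bool) (Fin 3 → Bool),
      P.correlation = magicSquareCorrelation) ∧
    (∀ (m n : Type) [Fintype m] [DecidableEq m] [Fintype n] [DecidableEq n] (ψ : m × n → ℂ),
      star ψ ⬝ᵥ ψ = 1 →
      ∀ q : Correlation (Fin 3) (Fin 3) (Fin 3 → Bool) (Fin 3 → Bool),
        IsQuantumWithSharedRandomness ψ q → magicSquareGame.IsWonBy q → 4 ∣ schmidtRank ψ) :=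
  ⟨isWonBy_magicSquareCorrelation,
    isMagicSquare_merminSquare.isQuantum isHermitian_merminSquare isMaximallyEntangled_magicState,
    ⟨magicSquareProtocol, magicSquareProtocol_correlation⟩,
    fun _ _ _ _ _ _ _ hψ _ hq hwin => four_dvd_schmidtRank_of_isWonBy hψ hq hwin⟩

theorem mainTheorem11 :
    -- the magic square correlations are those of a quantum winning strategy
    magicSquareGame.IsWonBy magicSquareCorrelation ∧
    IsQuantum magicState magicSquareCorrelation ∧
    -- one use of a non-local box simulates them
    (∃ P : NLBProtocol (Fin 3) (Fin 3) (Fin 3 → Bool) (Fin 3 → Bool),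
      P.correlation = magicSquareCorrelation) ∧
    -- no pair of qubits produces them, or any other correlation that wins the game
    (∀ α β : ℂ, ‖α‖ ^ 2 + ‖β‖ ^ 2 = 1 →
      ¬ IsQuantumWithSharedRandomness (qubitPair α β) magicSquareCorrelation ∧
      ∀ q : Correlation (Fin 3) (Fin 3) (Fin 3 → Bool) (Fin 3 → Bool),
        IsQuantumWithSharedRandomness (qubitPair α β) q → ¬ magicSquareGame.IsWonBy q) := by
  obtain ⟨hwin, hquantum, hnlb, hrank⟩ := mainTheorem11_general
  have hlose {α β} (h : ‖α‖ ^ 2 + ‖β‖ ^ 2 = 1) q (hq : IsQuantumWithSharedRandomness _ q) hq' :=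
    not_four_dvd_schmidtRank_qubitPair h (hrank _ _ _ (star_qubitPair_dotProduct h) q hq hq')
  exact ⟨hwin, hquantum, hnlb, fun α β h => ⟨fun hq => hlose h _ hq hwin, hlose h⟩⟩
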